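/- Let $(X,d)$ be an infinite metric space and let $\mathfrak B$ be a bornology on $X$, that is, a family of subsets of $X$ that covers $X$, is hereditary (closed under subsets) and is closed under finite unions. Assume that $X\notin\mathfrak B$ and that $\mathfrak B$ has a closed base, i.e. there is a family $\mathfrak B_0\subseteq\mathfrak B$ of closed sets such that every $B\in\mathfrak B$ is contained in some $B_0\in\mathfrak B_0$. For $B\subseteq X$ and $\delta>0$ put $B^\delta=\bigcup_{x\in B}\{y\in X: d(x,y)<\delta\}$. A cover $\mathcal U$ of $X$ is a $\mathfrak B^s$-cover if $X\notin\mathcal U$ and for each $B\in\mathfrak B$ there are $U\in\mathcal U$ and $\delta>0$ with $B^\delta\subseteq U$; it is an open $\mathfrak B^s$-cover if moreover all its members are open. Let $\mathcal O_{\mathfrak B^s}$ be the class of all open $\mathfrak B^s$-covers, and let $\mathcal O^{gp}_{\mathfrak B^s}$ be the class of those $\mathcal U\in\mathcal O_{\mathfrak B^s}$ that are $\mathfrak B^s$-groupable, i.e. $\mathcal U=\bigcup_{n\in\mathbb N}\mathcal U_n$ for a sequence of finite pairwise disjoint sets $\mathcal U_n$ such that for each $B\in\mathfrak B$ there is $n_0$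 such that for every $n\ge n_0$ there are $U\in\mathcal U_n$ and $\delta_n>0$ with $B^{\delta_n}\subseteq U$. The space $X$ is $\mathfrak B^s$-Lindelöf if each $\mathfrak B^s$-cover contains a countable $\mathfrak B^s$-cover. The space $X$ has the $\mathfrak B^s$-Hurewicz property if for each sequence $(\mathcal U_n)_{n\in\mathbb N}$ in $\mathcal O_{\mathfrak B^s}$ there are finite sets $\mathcal V_n\subseteq\mathcal U_n$ such that for each $B\in\mathfrak B$ there is $n_0$ such that for every $n\ge n_0$ there are $U\in\mathcal V_n$ and $\delta_n>0$ with $B^{\delta_n}\subseteq U$. For classes $\mathcal A,\mathcal B$ of sets: - $S_{fin}(\mathcal A,\mathcal B)$ means that for each sequence $(A_n)_{n\in\mathbb N}$ in $\mathcal A$ there are finite (possibly empty) sets $F_n\subseteq A_n$ with $\bigcup_n F_n\in\mathcal B$. - $G_{fin}(\mathcal A,\mathcal B)$ is the game in which, in round $n\in\mathbb N$, ONE chooses $A_n\in\mathcal A$ and TWO answers with a finite (possibly empty) set $F_n\subseteq A_n$; TWO wins the play if $\bigcup_n F_n\in\mathcal B$, and otherwise ONE wins. - For $\mathcal U\in\mathcal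 A$ and $k\ge1$, a function $f:[\mathcal U]^2\to\{1,\dots,k\}$ on the two-element subsets of $\mathcal U$ is a coloring if for each $U\in\mathcal U$ and each $\mathcal V\in\mathcal A$ with $\mathcal V\subseteq\mathcal U$ there is $i$ with $\{V\in\mathcal V: V\ne U,\ f(\{U,V\})=i\}\in\mathcal A$. The relation $\mathcal A\to\lceil\mathcal B\rceil^2_k$ means that for each $\mathcal U\in\mathcal A$ and each coloring $f:[\mathcal U]^2\to\{1,\dots,k\}$ there are $i\in\{1,\dots,k\}$, a set $\mathcal V\in\mathcal B$ with $\mathcal V\subseteq\mathcal U$, and a finite-to-one function $\varphi:\mathcal V\to\mathbb N$ such that $f(\{V,W\})=i$ for all $V,W\in\mathcal V$ with $\varphi(V)\ne\varphi(W)$. Theorem. The following statements are equivalent: 1. $X$ has the $\mathfrak B^s$-Hurewicz property. 2. $S_{fin}(\mathcal O_{\mathfrak B^s},\mathcal O^{gp}_{\mathfrak B^s})$ holds. 3. ONE has no winning strategy in $G_{fin}(\mathcal O_{\mathfrak B^s},\mathcal O^{gp}_{\mathfrak B^s})$. If moreover $X$ is $\mathfrak B^s$-Lindelöf, then these are also equivalent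 to: 4. $\mathcal O_{\mathfrak B^s}\to\lceil\mathcal O^{gp}_{\mathfrak B^s}\rceil^2_k$ holds for every integer $k\ge1$. -/

import Mathlib

open Set

namespace BornCover

/-! ### Selection principle, game and partition relation for classes of sets -/

section Selection

variable {α : Type*}

/-- The selection principle `S_fin(𝒜, ℬ)`: from every sequence of members `A n` of `𝒜` one can
select finite (possibly empty) subsets `F n ⊆ A n` whose union belongs to `ℬ`. -/
def SFin (𝒜 ℬ : Set (Set α)) : Prop :=
  ∀ A : ℕ → Set α, (∀ n, A n ∈ 𝒜) →
    ∃ F : ℕ → Set α, (∀ n, (F n).Finite ∧ F n ⊆ A n) ∧ (⋃ n, F n) ∈ ℬ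

/-- A strategy of ONE in the game `G_fin(𝒜, ℬ)`: the next move of ONE, a member of `𝒜`, as a
function of the list of all previous moves of TWO (the empty list gives the first move). -/
abbrev OneStrategy (𝒜 : Set (Set α)) : Type _ := List (Set α) → 𝒜

/-- `F 0, F 1, …` is a legal sequence of answers of TWO when ONE follows `σ`: in each inning TWO
picks a finite (possibly empty) subset of the set that ONE has just played. -/
def IsPlayAgainst {𝒜 : Set (Set α)} (σ : OneStrategy 𝒜) (F : ℕ → Set α) : Prop :=
  ∀ n, (F n).Finite ∧ F n ⊆ (σ ((List.range n).map F) : Set α)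

/-- The strategy `σ` of ONE is winning in `G_fin(𝒜, ℬ)`: ONE wins every play in which `σ` is
followed, that is, the union of the answers of TWO never belongs to `ℬ`. -/
def OneStrategy.IsWinning {𝒜 : Set (Set α)} (σ : OneStrategy 𝒜) (ℬ : Set (Set α)) : Prop :=
  ∀ F : ℕ → Set α, IsPlayAgainst σ F → (⋃ n, F n) ∉ ℬ

/-- ONE has a winning strategy in the game `G_fin(𝒜, ℬ)`. -/
def OneHasWinningStrategy (𝒜 ℬ : Set (Set α)) : Prop :=
  ∃ σ : OneStrategy 𝒜, σ.IsWinning ℬ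

/-- `f` is a coloring of the two-element subsets of `U` (relative to `𝒜`): for each `u ∈ U` and
each `V ∈ 𝒜` with `V ⊆ U` there is a color `i` such that `{v ∈ V : f {u, v} = i}` is in `𝒜`.
A two-element set is an unordered pair off the diagonal; only the values of `f` on pairs of
distinct elements of `U` are ever used. -/
def IsColoring (𝒜 : Set (Set α)) (U : Set α) {k : ℕ} (f : Sym2 α → Fin k) : Prop :=
  ∀ u ∈ U, ∀ V ∈ 𝒜, V ⊆ U → ∃ i : Fin k, {v ∈ V | v ≠ u ∧ f s(u, v) = i} ∈ 𝒜

/-- The Baumgartner–Taylor partition relation `𝒜 → ⌈ℬ⌉²_k`. -/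
def BaumgartnerTaylor (𝒜 ℬ : Set (Set α)) (k : ℕ) : Prop :=
  ∀ U ∈ 𝒜, ∀ f : Sym2 α → Fin k, IsColoring 𝒜 U f →
    ∃ i : Fin k, ∃ V ∈ ℬ, V ⊆ U ∧
      ∃ φ : V → ℕ, (∀ m, (φ ⁻¹' {m}).Finite) ∧
        ∀ v w : V, φ v ≠ φ w → f s((v : α), (w : α)) = i

end Selection

/-! ### Bornological covers of a metric space -/

section Covers

variable {X : Type*} [MetricSpace X]

/-- The family of sets of the bornology `𝔅` (which need not be the metric bornology of `X`):
it covers `X`, is hereditary and is closed under finite unions. -/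
def sets (𝔅 : Bornology X) : Set (Set X) := {B | @Bornology.IsBounded X 𝔅 B}

/-- `𝔅` has a closed base: a cofinal subfamily that consists of closed sets. -/
def HasClosedBase (𝔅 : Bornology X) : Prop :=
  ∃ 𝔅₀ ⊆ sets 𝔅, (∀ B ∈ 𝔅₀, IsClosed B) ∧ ∀ B ∈ sets 𝔅, ∃ B₀ ∈ 𝔅₀, B ⊆ B₀

/-- `U` contains `B` strongly: `B^δ ⊆ U` for some `δ > 0`, where `B^δ` is the union of the open
balls of radius `δ` centred at the points of `B`. -/
def StrongSubset (B U : Set X) : Prop := ∃ δ : ℝ, 0 < δ ∧ (⋃ x ∈ B, Metric.ball x δ) ⊆ U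

/-- `𝒰` is a `𝔅ˢ`-cover (strong `𝔅`-cover) of `X`. -/
def IsStrongCover (𝔅 : Bornology X) (𝒰 : Set (Set X)) : Prop :=
  ⋃₀ 𝒰 = univ ∧ univ ∉ 𝒰 ∧ ∀ B ∈ sets 𝔅, ∃ U ∈ 𝒰, StrongSubset B U

/-- The class `𝒪_{𝔅ˢ}` of all open `𝔅ˢ`-covers of `X`. -/
def openCovers (𝔅 : Bornology X) : Set (Set (Set X)) :=
  {𝒰 | IsStrongCover 𝔅 𝒰 ∧ ∀ U ∈ 𝒰, IsOpen U}

/-- `X` is `𝔅ˢ`-Lindelöf: each `𝔅ˢ`-cover contains a countable `𝔅ˢ`-subcover. -/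
def IsStrongLindelof (𝔅 : Bornology X) : Prop :=
  ∀ 𝒰 : Set (Set X), IsStrongCover 𝔅 𝒰 → ∃ 𝒱 ⊆ 𝒰, 𝒱.Countable ∧ IsStrongCover 𝔅 𝒱

/-- Each `B ∈ 𝔅` is, for all but finitely many `n`, strongly contained in a member of `𝒱 n`. -/
def EventuallyStrong (𝔅 : Bornology X) (𝒱 : ℕ → Set (Set X)) : Prop :=
  ∀ B ∈ sets 𝔅, ∃ n₀ : ℕ, ∀ n ≥ n₀, ∃ U ∈ 𝒱 n, StrongSubset B U

/-- `𝒰` is `𝔅ˢ`-groupable: it is the union of a sequence of pairwise disjoint finite sets `𝒱 n`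
such that each `B ∈ 𝔅` is, for all but finitely many `n`, strongly contained in a member of
`𝒱 n`. -/
def IsGroupable (𝔅 : Bornology X) (𝒰 : Set (Set X)) : Prop :=
  ∃ 𝒱 : ℕ → Set (Set X), (∀ n, (𝒱 n).Finite) ∧ (∀ m n, m ≠ n → Disjoint (𝒱 m) (𝒱 n)) ∧
    𝒰 = ⋃ n, 𝒱 n ∧ EventuallyStrong 𝔅 𝒱

/-- The class `𝒪^{gp}_{𝔅ˢ}` of all `𝔅ˢ`-groupable open `𝔅ˢ`-covers of `X`. -/
def groupableCovers (𝔅 : Bornology X) : Set (Set (Set X)) :=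
  {𝒰 | 𝒰 ∈ openCovers 𝔅 ∧ IsGroupable 𝔅 𝒰}

/-- The `𝔅ˢ`-Hurewicz property of `X`. -/
def HurewiczProperty (𝔅 : Bornology X) : Prop :=
  ∀ 𝒰 : ℕ → Set (Set X), (∀ n, 𝒰 n ∈ openCovers 𝔅) →
    ∃ 𝒱 : ℕ → Set (Set X), (∀ n, (𝒱 n).Finite ∧ 𝒱 n ⊆ 𝒰 n) ∧ EventuallyStrong 𝔅 𝒱

end Covers

end BornCover

namespace BornCover

section Families

variable {X : Type*} {𝔅 : Bornology X}

/-! Open strong covers are infinite, and any finite splitting leaves one piece a cover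
(`exists_inter_mem_openCovers`). The Hurewicz property makes each move of ONE reducible to a
countable cover, so a strategy of ONE lives on a countable tree of positions; one application of the
property to the whole tree gives answers whose branch is groupable, which beats the strategy.
Conversely, selecting from common refinements and regrouping recovers the Hurewicz property
(`exists_eventuallyStrong_of_grouping`). For the partition relation, a fusion argument fixes one
color in which ONE can always continue, and a play won by TWO is the homogeneous set. Conversely,
two colors on a cover labelled by naturals, for equal and unequal labels, force finitely many sets
per label, and regrouping applies again. -/

theorem finite_mem_sets {B : Set X} (hB : B.Finite) : B ∈ sets 𝔅 :=
  @Set.Finite.isBounded X 𝔅 B hB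

theorem iUnion_mem_sets {ι : Type*} [Finite ι] {B : ι → Set X} (hB : ∀ i, B i ∈ sets 𝔅) :
    (⋃ i, B i) ∈ sets 𝔅 :=
  (@Bornology.isBounded_iUnion ι X 𝔅 _ B).2 hB

/-- The common refinement of `𝒰 0, …, 𝒰 n` by intersections. -/
def commonRefinement (𝒰 : ℕ → Set (Set X)) : ℕ → Set (Set X)
  | 0 => 𝒰 0
  | n + 1 => image2 (· ∩ ·) (commonRefinement 𝒰 n) (𝒰 (n + 1))

theorem exists_superset_of_mem_commonRefinement {𝒰 : ℕ → Set (Set X)} {m n : ℕ} (hmn : m ≤ n)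
    {W : Set X} (hW : W ∈ commonRefinement 𝒰 n) : ∃ U ∈ 𝒰 m, W ⊆ U := by
  induction n generalizing W with
  | zero => exact ⟨W, by rwa [Nat.le_zero.1 hmn], subset_rfl⟩
  | succ n ih =>
    obtain ⟨U, hU, V, hV, rfl⟩ := hW
    rcases Nat.le_succ_iff.1 hmn with h | rfl
    · obtain ⟨U', hU', hs⟩ := ih h hU
      exact ⟨U', hU', inter_subset_left.trans hs⟩
    · exact ⟨V, hV, inter_subset_right⟩

end Families

section Covers

variable {X : Type*} [MetricSpace X] {𝔅 : Bornology X} {𝒰 𝒱 : Set (Set X)}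

/-! ### Strong inclusion and open strong covers. -/

theorem StrongSubset.mono {A B U V : Set X} (h : StrongSubset B U) (hA : A ⊆ B) (hU : U ⊆ V) :
    StrongSubset A V := by
  obtain ⟨δ, hδ, h⟩ := h
  exact ⟨δ, hδ, (biUnion_subset_biUnion_left hA).trans (h.trans hU)⟩

theorem StrongSubset.inter {B U V : Set X} (hU : StrongSubset B U) (hV : StrongSubset B V) :
    StrongSubset B (U ∩ V) := by
  obtain ⟨δ, hδ, hU⟩ := hU
  obtain ⟨ε, hε, hV⟩ := hV
  refine ⟨min δ ε, lt_min hδ hε, subset_inter ?_ ?_⟩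
  · exact (iUnion₂_mono fun x _ => Metric.ball_subset_ball (min_le_left _ _)).trans hU
  · exact (iUnion₂_mono fun x _ => Metric.ball_subset_ball (min_le_right _ _)).trans hV

theorem StrongSubset.subset {B U : Set X} (h : StrongSubset B U) : B ⊆ U := by
  obtain ⟨δ, hδ, h⟩ := h
  exact fun x hx => h (mem_biUnion hx (Metric.mem_ball_self hδ))

theorem mem_openCovers_iff :
    𝒰 ∈ openCovers 𝔅 ↔ univ ∉ 𝒰 ∧ (∀ B ∈ sets 𝔅, ∃ U ∈ 𝒰, StrongSubset B U) ∧
      ∀ U ∈ 𝒰, IsOpen U := by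
  refine ⟨fun h => ⟨h.1.2.1, h.1.2.2, h.2⟩, fun h => ⟨⟨?_, h.1, h.2.1⟩, h.2.2⟩⟩
  refine eq_univ_of_forall fun x => ?_
  obtain ⟨U, hU, hx⟩ := h.2.1 {x} (finite_mem_sets (finite_singleton x))
  exact ⟨U, hU, hx.subset rfl⟩

theorem openCovers_of_subset (h𝒰 : 𝒰 ∈ openCovers 𝔅) (h : 𝒱 ⊆ 𝒰)
    (hB : ∀ B ∈ sets 𝔅, ∃ U ∈ 𝒱, StrongSubset B U) : 𝒱 ∈ openCovers 𝔅 := by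
  rw [mem_openCovers_iff] at *
  exact ⟨fun hu => h𝒰.1 (h hu), hB, fun U hU => h𝒰.2.2 U (h hU)⟩

theorem openCovers_of_subset_subset {𝒲 : Set (Set X)} (h𝒰 : 𝒰 ∈ openCovers 𝔅)
    (h𝒲 : 𝒲 ∈ openCovers 𝔅) (h : 𝒱 ⊆ 𝒰) (h' : 𝒲 ⊆ 𝒱) : 𝒱 ∈ openCovers 𝔅 :=
  openCovers_of_subset h𝒰 h fun B hB =>
    let ⟨U, hU, hBU⟩ := (mem_openCovers_iff.1 h𝒲).2.1 B hB
    ⟨U, h' hU, hBU⟩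

/-- When an open strong cover is split into finitely many pieces, one piece is such a cover. -/
theorem exists_inter_mem_openCovers {ι : Type*} [Finite ι] {𝒲 : ι → Set (Set X)}
    (h𝒰 : 𝒰 ∈ openCovers 𝔅) (h : 𝒰 ⊆ ⋃ i, 𝒲 i) : ∃ i, 𝒰 ∩ 𝒲 i ∈ openCovers 𝔅 := by
  by_contra! hc
  have key : ∀ i, ∃ B ∈ sets 𝔅, ∀ U ∈ 𝒰 ∩ 𝒲 i, ¬ StrongSubset B U := by
    intro i
    by_contra! hi
    exact hc i (openCovers_of_subset h𝒰 inter_subset_left hi)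
  choose B hB hBU using key
  -- The union of the witnesses is still in `𝔅` and defeats every piece at once.
  obtain ⟨U, hU, hs⟩ := (mem_openCovers_iff.1 h𝒰).2.1 _ (iUnion_mem_sets hB)
  obtain ⟨i, hi⟩ := mem_iUnion.1 (h hU)
  exact hBU i U ⟨hU, hi⟩ (hs.mono (subset_iUnion B i) subset_rfl)

/-- Pick a point outside each member: if there were finitely many, these points would form a set of
`𝔅` that no member contains. -/
theorem infinite_of_mem_openCovers (h𝒰 : 𝒰 ∈ openCovers 𝔅) : 𝒰.Infinite := by
  intro hfin
  rw [mem_openCovers_iff] at h𝒰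
  have hx : ∀ U : 𝒰, ∃ x, x ∉ (U : Set X) := fun U =>
    (ne_univ_iff_exists_notMem _).1 fun h => h𝒰.1 (h ▸ U.2)
  choose x hx using hx
  have := hfin.to_subtype
  obtain ⟨U, hU, hs⟩ := h𝒰.2.1 (range x) (finite_mem_sets (finite_range x))
  exact hx ⟨U, hU⟩ (hs.subset (mem_range_self _))

theorem diff_finite_mem_openCovers (h𝒰 : 𝒰 ∈ openCovers 𝔅) (h𝒱 : 𝒱.Finite) :
    𝒰 \ 𝒱 ∈ openCovers 𝔅 := by
  obtain ⟨b, hb⟩ := exists_inter_mem_openCovers (𝒲 := fun b : Bool => cond b 𝒱ᶜ 𝒱) h𝒰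
    fun U _ => mem_iUnion.2 (by
      by_cases h : U ∈ 𝒱
      · exact ⟨false, h⟩
      · exact ⟨true, h⟩)
  cases b
  · exact absurd (h𝒱.subset inter_subset_right) (infinite_of_mem_openCovers hb)
  · exact hb

theorem not_forall_subset_of_mem_openCovers (h𝒰 : 𝒰 ∈ openCovers 𝔅) {U : Set X}
    (hU : U ≠ univ) : ¬ ∀ V ∈ 𝒰, V ⊆ U := by
  intro h
  refine hU (univ_subset_iff.1 ?_)
  rw [← h𝒰.1.1]
  exact sUnion_subset h

theorem image2_inter_mem_openCovers (h𝒰 : 𝒰 ∈ openCovers 𝔅) (h𝒱 : 𝒱 ∈ openCovers 𝔅) :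
    image2 (· ∩ ·) 𝒰 𝒱 ∈ openCovers 𝔅 := by
  rw [mem_openCovers_iff] at *
  refine ⟨?_, fun B hB => ?_, ?_⟩
  · rintro ⟨U, hU, V, hV, h⟩
    exact h𝒰.1 ((univ_subset_iff.1 (h.ge.trans inter_subset_left)) ▸ hU)
  · obtain ⟨U, hU, hBU⟩ := h𝒰.2.1 B hB
    obtain ⟨V, hV, hBV⟩ := h𝒱.2.1 B hB
    exact ⟨_, mem_image2_of_mem hU hV, hBU.inter hBV⟩
  · rintro _ ⟨U, hU, V, hV, rfl⟩
    exact (h𝒰.2.2 U hU).inter (h𝒱.2.2 V hV)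

theorem commonRefinement_mem_openCovers {𝒰 : ℕ → Set (Set X)} (h : ∀ n, 𝒰 n ∈ openCovers 𝔅)
    (n : ℕ) : commonRefinement 𝒰 n ∈ openCovers 𝔅 := by
  induction n with
  | zero => exact h 0
  | succ n ih => exact image2_inter_mem_openCovers ih (h _)

/-! ### From selections back to the Hurewicz property. -/

/-- A grouping whose members refine `𝒰 0, …, 𝒰 (r V)` for a rank `r` with finite sublevel sets
yields finite selections from the `𝒰 n` that eventually strongly contain every `B ∈ 𝔅`. -/
theorem exists_eventuallyStrong_of_grouping {𝒰 𝒢 : ℕ → Set (Set X)} (hfin : ∀ n, (𝒢 n).Finite)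
    (hdisj : ∀ m n, m ≠ n → Disjoint (𝒢 m) (𝒢 n)) (hev : EventuallyStrong 𝔅 𝒢) (r : Set X → ℕ)
    (hr : ∀ n, {V ∈ ⋃ m, 𝒢 m | r V < n}.Finite)
    (hsub : ∀ V ∈ ⋃ m, 𝒢 m, ∀ n ≤ r V, ∃ U ∈ 𝒰 n, V ⊆ U) :
    ∃ 𝒱 : ℕ → Set (Set X), (∀ n, (𝒱 n).Finite ∧ 𝒱 n ⊆ 𝒰 n) ∧ EventuallyStrong 𝔅 𝒱 := by
  have hlarge : ∀ n, ∃ m, n ≤ m ∧ ∀ V ∈ 𝒢 m, n ≤ r V := by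
    intro n
    -- Each of the finitely many sets of rank below `n` lies in at most one group, as groups are
    -- disjoint.
    have hf : {m | ∃ V ∈ 𝒢 m, r V < n}.Finite := by
      have hm : ∀ V, {m | V ∈ 𝒢 m}.Subsingleton := fun V a ha b hb => by
        by_contra hab
        exact disjoint_left.1 (hdisj a b hab) ha hb
      refine ((hr n).biUnion (t := fun V => {m | V ∈ 𝒢 m}) fun V _ => (hm V).finite).subset ?_
      rintro m ⟨V, hV, hlt⟩
      exact mem_biUnion (x := V) ⟨mem_iUnion.2 ⟨m, hV⟩, hlt⟩ hV
    obtain ⟨m, hm, hnm⟩ := ((finite_lt_nat n).union hf).exists_notMem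
      |>.imp fun m hm => not_or.1 hm
    refine ⟨m, not_lt.1 hm, fun V hV => not_lt.1 fun h => hnm ⟨V, hV, h⟩⟩
  choose m hm hmr using hlarge
  have hU : ∀ n V, ∃ U, V ∈ 𝒢 (m n) → U ∈ 𝒰 n ∧ V ⊆ U := by
    intro n V
    by_cases hV : V ∈ 𝒢 (m n)
    · obtain ⟨U, hU⟩ := hsub V (mem_iUnion.2 ⟨_, hV⟩) n (hmr n V hV)
      exact ⟨U, fun _ => hU⟩
    · exact ⟨V, fun h => absurd h hV⟩
  choose u hu using hU
  refine ⟨fun n => u n '' 𝒢 (m n), fun n => ⟨(hfin _).image _, ?_⟩, fun B hB => ?_⟩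
  · rintro _ ⟨V, hV, rfl⟩
    exact (hu n V hV).1
  · obtain ⟨n₀, hn₀⟩ := hev B hB
    refine ⟨n₀, fun n hn => ?_⟩
    obtain ⟨V, hV, hBV⟩ := hn₀ (m n) (hn.trans (hm n))
    exact ⟨_, mem_image_of_mem _ hV, hBV.mono subset_rfl (hu n V hV).2⟩

theorem hurewiczProperty_of_sFin (h : SFin (openCovers 𝔅) (groupableCovers 𝔅)) :
    HurewiczProperty 𝔅 := by
  intro 𝒰 h𝒰
  obtain ⟨F, hF, -, 𝒢, hfin, hdisj, hG, hev⟩ := h _ (commonRefinement_mem_openCovers h𝒰)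
  have hr : ∀ V, ∃ j, V ∈ ⋃ m, 𝒢 m → V ∈ F j := by
    intro V
    by_cases hV : V ∈ ⋃ m, 𝒢 m
    · obtain ⟨j, hj⟩ := mem_iUnion.1 (hG ▸ hV)
      exact ⟨j, fun _ => hj⟩
    · exact ⟨0, fun h => absurd h hV⟩
  choose r hr using hr
  refine exists_eventuallyStrong_of_grouping hfin hdisj hev r (fun n => ?_) fun V hV n hn =>
    exists_superset_of_mem_commonRefinement hn ((hF _).2 (hr V hV))
  refine ((finite_lt_nat n).biUnion fun j _ => (hF j).1).subset ?_
  rintro V ⟨hV, hlt⟩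
  exact mem_biUnion (x := r V) hlt (hr V hV)

/-- ONE may ignore the answers and play `A n` in inning `n`. -/
theorem sFin_of_not_oneHasWinningStrategy {α : Type*} {𝒜 ℬ : Set (Set α)}
    (h : ¬ OneHasWinningStrategy 𝒜 ℬ) : SFin 𝒜 ℬ := by
  intro A hA
  by_contra! hc
  refine h ⟨fun p => ⟨A p.length, hA _⟩, fun F hF => hc F fun n => ?_⟩
  simpa using hF n

/-! ### The Hurewicz property defeats every strategy of ONE. -/

theorem HurewiczProperty.exists_finite_selection (h : HurewiczProperty 𝔅) {ι : Type*}
    [Countable ι] {𝒰 : ι → Set (Set X)} (h𝒰 : ∀ i, 𝒰 i ∈ openCovers 𝔅) :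
    ∃ 𝒱 : ι → Set (Set X), (∀ i, (𝒱 i).Finite ∧ 𝒱 i ⊆ 𝒰 i) ∧
      ∀ B ∈ sets 𝔅, {i | ¬ ∃ U ∈ 𝒱 i, StrongSubset B U}.Finite := by
  rcases isEmpty_or_nonempty ι with hι | hι
  · exact ⟨𝒰, fun i => hι.elim i, fun B _ => toFinite _⟩
  obtain ⟨g, hg⟩ := exists_surjective_nat ι
  obtain ⟨𝒱, h𝒱, hev⟩ := h (fun n => 𝒰 (g n)) fun n => h𝒰 _
  refine ⟨fun i => 𝒱 (Function.surjInv hg i), fun i => ?_, fun B hB => ?_⟩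
  · simpa only [Function.surjInv_eq hg i] using h𝒱 (Function.surjInv hg i)
  · obtain ⟨n₀, hn₀⟩ := hev B hB
    refine ((finite_lt_nat n₀).preimage (Function.injective_surjInv hg).injOn).subset ?_
    intro i hi
    by_contra hlt
    exact hi (hn₀ _ (not_lt.1 hlt))

theorem HurewiczProperty.exists_range_mem_openCovers (h : HurewiczProperty 𝔅)
    (h𝒰 : 𝒰 ∈ openCovers 𝔅) : ∃ a : ℕ → Set X, range a ⊆ 𝒰 ∧ range a ∈ openCovers 𝔅 := by
  obtain ⟨𝒱, h𝒱, hev⟩ := h (fun _ => 𝒰) fun _ => h𝒰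
  have hsub : (⋃ n, 𝒱 n) ⊆ 𝒰 := iUnion_subset fun n => (h𝒱 n).2
  have hmem : (⋃ n, 𝒱 n) ∈ openCovers 𝔅 := openCovers_of_subset h𝒰 hsub fun B hB => by
    obtain ⟨n, hn⟩ := hev B hB
    obtain ⟨U, hU, hBU⟩ := hn n le_rfl
    exact ⟨U, mem_iUnion.2 ⟨n, hU⟩, hBU⟩
  obtain ⟨a, ha⟩ := (countable_iUnion fun n => (h𝒱 n).1.countable).exists_eq_range
    (infinite_of_mem_openCovers hmem).nonempty
  exact ⟨a, ha ▸ hsub, ha ▸ hmem⟩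

/-- The list of moves coded by a list of finite sets of indices, latest move first, when a move
after the position `p` is coded by means of the enumeration `a p`. -/
def decodePosition {α : Type*} (a : List (Set α) → ℕ → α) : List (Finset ℕ) → List (Set α)
  | [] => []
  | s :: l => decodePosition a l ++ [a (decodePosition a l) '' s]

theorem finite_of_mem_decodePosition {α : Type*} {a : List (Set α) → ℕ → α} {l : List (Finset ℕ)}
    {F : Set α} (hF : F ∈ decodePosition a l) : F.Finite := by
  induction l with
  | nil => simp [decodePosition] at hF
  | cons s l ih =>
    rcases List.mem_append.1 hF with h | h
    · exact ih h
    · rw [List.mem_singleton.1 h]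
      exact s.finite_toSet.image _

theorem HurewiczProperty.not_oneHasWinningStrategy (h : HurewiczProperty 𝔅) :
    ¬ OneHasWinningStrategy (openCovers 𝔅) (groupableCovers 𝔅) := by
  rintro ⟨σ, hσ⟩
  -- Removing earlier answers makes the answers of a play disjoint. Positions with an infinite entry
  -- get a junk value.
  have ha : ∀ p : List (Set (Set X)), ∃ a : ℕ → Set X, (∀ F ∈ p, F.Finite) →
      range a ⊆ (σ p : Set (Set X)) \ (⋃ F ∈ {F | F ∈ p}, F) ∧ range a ∈ openCovers 𝔅 := by
    intro p
    by_cases hp : ∀ F ∈ p, F.Finite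
    · obtain ⟨a, ha⟩ := h.exists_range_mem_openCovers
        (diff_finite_mem_openCovers (σ p).2 ((List.finite_toSet p).biUnion hp))
      exact ⟨a, fun _ => ha⟩
    · exact ⟨fun _ => ∅, fun h => absurd h hp⟩
  choose a ha using ha
  have ha' : ∀ l, range (a (decodePosition a l)) ⊆
      (σ (decodePosition a l) : Set (Set X)) \ (⋃ F ∈ {F | F ∈ decodePosition a l}, F) ∧
      range (a (decodePosition a l)) ∈ openCovers 𝔅 :=
    fun l => ha _ fun F hF => finite_of_mem_decodePosition hF
  obtain ⟨𝒱, h𝒱, hev⟩ := h.exists_finite_selection fun l => (ha' l).2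
  have hs : ∀ l, ∃ s : Finset ℕ, a (decodePosition a l) '' s = 𝒱 l := by
    intro l
    choose! g hg using fun V (hV : V ∈ 𝒱 l) => (h𝒱 l).2 hV
    refine ⟨((h𝒱 l).1.image g).toFinset, ?_⟩
    rw [Finite.coe_toFinset, image_image]
    exact (image_congr hg).trans (image_id' _)
  choose s hs using hs
  -- The branch on which TWO always gives the selected answer. Its positions have distinct lengths,
  -- so finitely many bad positions mean finitely many bad innings.
  let L : ℕ → List (Finset ℕ) := fun n => Nat.rec [] (fun _ l => s l :: l) n
  have hL : ∀ n, L (n + 1) = s (L n) :: L n := fun n => rfl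
  have hLlen : ∀ n, (L n).length = n := by
    intro n
    induction n with
    | zero => rfl
    | succ n ih => rw [hL, List.length_cons, ih]
  have hLinj : Function.Injective L := fun m n hmn => by rw [← hLlen m, hmn, hLlen]
  let F : ℕ → Set (Set X) := fun n => 𝒱 (L n)
  have hdec : ∀ n, (List.range n).map F = decodePosition a (L n) := by
    intro n
    induction n with
    | zero => rfl
    | succ n ih => rw [List.range_succ, List.map_append, ih, hL, decodePosition, hs]; rfl
  have hFsub : ∀ n, F n ⊆ (σ ((List.range n).map F) : Set (Set X)) \
      (⋃ G ∈ {G | G ∈ (List.range n).map F}, G) := by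
    intro n
    rw [hdec]
    exact (h𝒱 _).2.trans (ha' _).1
  have hlt : ∀ m n, m < n → Disjoint (F m) (F n) := by
    intro m n hmn
    refine disjoint_left.2 fun U hm hn => (hFsub n hn).2 ?_
    exact mem_biUnion (x := F m) (List.mem_map_of_mem (List.mem_range.2 hmn)) hm
  have hstrong : EventuallyStrong 𝔅 F := by
    intro B hB
    obtain ⟨n₀, hn₀⟩ := ((hev B hB).preimage hLinj.injOn).bddAbove
    refine ⟨n₀ + 1, fun n hn => ?_⟩
    by_contra hc
    exact absurd (hn₀ (a := n) hc) (by omega)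
  refine hσ F (fun n => ⟨(h𝒱 _).1, (hFsub n).trans sdiff_subset⟩)
    ⟨mem_openCovers_iff.2 ⟨?_, fun B hB => ?_, fun U hU => ?_⟩, F, fun n => (h𝒱 _).1, ?_, rfl,
      hstrong⟩
  · intro hU
    obtain ⟨n, hn⟩ := mem_iUnion.1 hU
    exact (mem_openCovers_iff.1 (σ _).2).1 (hFsub n hn).1
  · obtain ⟨n, hn⟩ := hstrong B hB
    obtain ⟨U, hU, hBU⟩ := hn n le_rfl
    exact ⟨U, mem_iUnion.2 ⟨n, hU⟩, hBU⟩
  · obtain ⟨n, hn⟩ := mem_iUnion.1 hU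
    exact (σ _).2.2 U (hFsub n hn).1
  · intro m n hmn
    rcases hmn.lt_or_gt with h | h
    · exact hlt m n h
    · exact (hlt n m h).symm

/-! ### The partition relation. -/

/-- For a coloring of the pairs of a countable cover there are a color `j` and a set `𝒲` such that
any finitely many members of `𝒲` have color `j` with all members of some cover inside `𝒲`. -/
theorem exists_homogeneous_extension {k : ℕ} {a : ℕ → Set X} (ha : range a ∈ openCovers 𝔅)
    {f : Sym2 (Set X) → Fin k} (hf : IsColoring (openCovers 𝔅) (range a) f) :
    ∃ j, ∃ 𝒲 ⊆ range a, ∀ F ⊆ 𝒲, F.Finite → ∃ 𝒞 ∈ openCovers 𝔅, 𝒞 ⊆ 𝒲 ∧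
      ∀ V ∈ F, ∀ W ∈ 𝒞, f s(V, W) = j := by
  choose c hc using fun n => hf (a n) (mem_range_self n)
  let C : ℕ → {𝒞 : Set (Set X) // 𝒞 ∈ openCovers 𝔅 ∧ 𝒞 ⊆ range a} := fun n =>
    Nat.rec ⟨range a, ha, subset_rfl⟩
      (fun n 𝒞 => ⟨_, hc n 𝒞.1 𝒞.2.1 𝒞.2.2, (sep_subset _ _).trans 𝒞.2.2⟩) n
  let i : ℕ → Fin k := fun n => c n (C n).1 (C n).2.1 (C n).2.2
  have hC : ∀ n, (C (n + 1)).1 = {v ∈ (C n).1 | v ≠ a n ∧ f s(a n, v) = i n} := fun n => rfl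
  have hanti : Antitone fun n => (C n).1 :=
    antitone_nat_of_succ_le fun n => by rw [hC]; exact sep_subset _ _
  -- If every color `j` failed at some stage `N j`, then splitting a stage beyond all of them by
  -- color would give a contradiction.
  have hj : ∃ j, ∀ n, (C n).1 ∩ a '' {m | i m = j} ∈ openCovers 𝔅 := by
    by_contra! hno
    choose N hN using hno
    obtain ⟨M, hM⟩ := (finite_range N).bddAbove
    obtain ⟨j, hj⟩ := exists_inter_mem_openCovers (𝒲 := fun j => a '' {m | i m = j})
      (C M).2.1 fun V hV => by
        obtain ⟨m, rfl⟩ := (C M).2.2 hV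
        exact mem_iUnion.2 ⟨i m, m, rfl, rfl⟩
    exact hN j (openCovers_of_subset_subset (C (N j)).2.1 hj inter_subset_left
      (inter_subset_inter_left _ (hanti (hM (mem_range_self j)))))
  obtain ⟨j, hj⟩ := hj
  refine ⟨j, a '' {m | i m = j}, image_subset_range _ _, fun F hF hFfin => ?_⟩
  choose! m hmj hm using fun V (hV : V ∈ F) => hF hV
  obtain ⟨M, hM⟩ := (hFfin.image m).bddAbove
  -- Stage `m + 1` is the first one adjusted to `a m`, hence `M + 1`.
  refine ⟨_, hj (M + 1), inter_subset_right, fun V hV W hW => ?_⟩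
  have h1 : W ∈ (C (m V + 1)).1 :=
    hanti (Nat.succ_le_succ (hM (mem_image_of_mem m hV))) hW.1
  rw [hC, hm V hV] at h1
  exact h1.2.2.trans (hmj V hV)

theorem HurewiczProperty.baumgartnerTaylor (h : HurewiczProperty 𝔅) (k : ℕ) :
    BaumgartnerTaylor (openCovers 𝔅) (groupableCovers 𝔅) k := by
  intro 𝒰 h𝒰 f hf
  obtain ⟨a, ha𝒰, ha⟩ := h.exists_range_mem_openCovers h𝒰
  obtain ⟨j, 𝒲, h𝒲, hext⟩ := exists_homogeneous_extension ha
    (f := f) fun u hu V hV hVa => hf u (ha𝒰 hu) V hV (hVa.trans ha𝒰)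
  -- ONE plays inside `𝒲`, with color `j` towards all earlier answers.
  have hmove : ∀ p : List (Set (Set X)), ∃ 𝒞 : openCovers 𝔅, (∀ F ∈ p, F ⊆ 𝒲 ∧ F.Finite) →
      𝒞.1 ⊆ 𝒲 ∧ ∀ F ∈ p, ∀ V ∈ F, ∀ W ∈ 𝒞.1, f s(V, W) = j := by
    intro p
    by_cases hp : ∀ F ∈ p, F ⊆ 𝒲 ∧ F.Finite
    · obtain ⟨𝒞, h𝒞, hs, hj⟩ := hext (⋃ F ∈ {F | F ∈ p}, F)
        (iUnion₂_subset fun F hF => (hp F hF).1)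
        ((List.finite_toSet p).biUnion fun F hF => (hp F hF).2)
      exact ⟨⟨𝒞, h𝒞⟩, fun _ => ⟨hs, fun F hF V hV => hj V (mem_biUnion hF hV)⟩⟩
    · exact ⟨⟨𝒰, h𝒰⟩, fun h => absurd h hp⟩
  choose σ hσ using hmove
  have hwin := h.not_oneHasWinningStrategy
  simp only [OneHasWinningStrategy, OneStrategy.IsWinning, not_exists, not_forall, not_not] at hwin
  obtain ⟨F, hF, hgp⟩ := hwin σ
  have hF𝒲 : ∀ n, F n ⊆ 𝒲 := by
    intro n
    induction n using Nat.strong_induction_on with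
    | _ n ih =>
      refine (hF n).2.trans (hσ _ fun G hG => ?_).1
      obtain ⟨m, hm, rfl⟩ := List.mem_map.1 hG
      exact ⟨ih m (List.mem_range.1 hm), (hF m).1⟩
  have hcol : ∀ m n, m < n → ∀ V ∈ F m, ∀ W ∈ F n, f s(V, W) = j := by
    intro m n hmn V hV W hW
    refine (hσ ((List.range n).map F) fun G hG => ?_).2 (F m)
      (List.mem_map_of_mem (List.mem_range.2 hmn)) V hV W ((hF n).2 hW)
    obtain ⟨l, -, rfl⟩ := List.mem_map.1 hG
    exact ⟨hF𝒲 l, (hF l).1⟩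
  choose φ hφ using fun V : (⋃ n, F n) => mem_iUnion.1 V.2
  refine ⟨j, ⋃ n, F n, hgp, iUnion_subset fun n => (hF𝒲 n).trans (h𝒲.trans ha𝒰), φ,
    fun m => ?_, fun V W hVW => ?_⟩
  · refine ((hF m).1.preimage Subtype.val_injective.injOn).subset ?_
    rintro V rfl
    exact hφ V
  · rcases hVW.lt_or_gt with hlt | hlt
    · exact hcol _ _ hlt _ (hφ V) _ (hφ W)
    · rw [Sym2.eq_swap]
      exact hcol _ _ hlt _ (hφ W) _ (hφ V)

theorem isColoring_openCovers {k : ℕ} (f : Sym2 (Set X) → Fin k) :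
    IsColoring (openCovers 𝔅) 𝒰 f := by
  intro u _ 𝒱 h𝒱 _
  obtain ⟨i, hi⟩ := exists_inter_mem_openCovers (𝒲 := fun i => {v | f s(u, v) = i})
    (diff_finite_mem_openCovers h𝒱 (finite_singleton u)) fun v _ => mem_iUnion.2 ⟨_, rfl⟩
  refine ⟨i, openCovers_of_subset_subset h𝒱 hi (sep_subset _ _) fun v hv => ?_⟩
  exact ⟨hv.1.1, hv.1.2, hv.2⟩

theorem hurewiczProperty_of_baumgartnerTaylor (hL : IsStrongLindelof 𝔅)
    (h : BaumgartnerTaylor (openCovers 𝔅) (groupableCovers 𝔅) 2) : HurewiczProperty 𝔅 := by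
  intro 𝒰 h𝒰
  obtain ⟨𝒜, h𝒜, hcount, hcov⟩ := hL _ (h𝒰 0).1
  have h𝒜' : 𝒜 ∈ openCovers 𝔅 := ⟨hcov, fun U hU => (h𝒰 0).2 U (h𝒜 hU)⟩
  obtain ⟨a, rfl⟩ := hcount.exists_eq_range (infinite_of_mem_openCovers h𝒜').nonempty
  have haU := mem_openCovers_iff.1 h𝒜'
  -- Intersecting with `a n` keeps all sets of label `n` inside one proper subset of `X`.
  let 𝒟 : Set (Set X) := {V | ∃ n, ∃ W ∈ commonRefinement 𝒰 n, V = a n ∩ W}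
  have h𝒟 : 𝒟 ∈ openCovers 𝔅 := by
    refine mem_openCovers_iff.2 ⟨?_, fun B hB => ?_, ?_⟩
    · rintro ⟨n, W, -, hV⟩
      exact haU.1 ⟨n, univ_subset_iff.1 (hV.subset.trans inter_subset_left)⟩
    · obtain ⟨_, ⟨n, rfl⟩, hBn⟩ := haU.2.1 B hB
      obtain ⟨W, hW, hBW⟩ :=
        (mem_openCovers_iff.1 (commonRefinement_mem_openCovers h𝒰 n)).2.1 B hB
      exact ⟨_, ⟨n, W, hW, rfl⟩, hBn.inter hBW⟩
    · rintro _ ⟨n, W, hW, rfl⟩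
      exact (haU.2.2 _ (mem_range_self n)).inter ((commonRefinement_mem_openCovers h𝒰 n).2 W hW)
  choose! r w hw hrw using fun V (hV : V ∈ 𝒟) => hV
  let f : Sym2 (Set X) → Fin 2 := Sym2.lift
    ⟨fun V W => if r V = r W then 0 else 1, fun V W => by simp only [eq_comm]⟩
  have hf : ∀ V W, f s(V, W) = if r V = r W then 0 else 1 := fun V W => rfl
  obtain ⟨i, 𝒱, ⟨h𝒱, 𝒢, hfin, hdisj, rfl, hev⟩, hsub, φ, hφ, hi⟩ :=
    h 𝒟 h𝒟 f (isColoring_openCovers f)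
  have hφ' : ∀ m, {V | ∃ hV, φ ⟨V, hV⟩ = m}.Finite := fun m =>
    ((hφ m).image Subtype.val).subset fun V ⟨hV, hm⟩ => ⟨⟨V, hV⟩, hm, rfl⟩
  have hone : ∀ V W, φ V ≠ φ W → r V ≠ r W := by
    obtain rfl | rfl : i = 0 ∨ i = 1 := by omega
    -- Color 0: outside one finite fibre of `φ` all labels agree, so what remains is a cover lying
    -- inside a single `a (r V)`.
    · exfalso
      obtain ⟨V, hV⟩ := (infinite_of_mem_openCovers h𝒱).nonempty
      refine not_forall_subset_of_mem_openCovers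
        (diff_finite_mem_openCovers h𝒱 (hφ' (φ ⟨V, hV⟩)))
        (U := a (r V)) (fun hu => haU.1 ⟨_, hu⟩) fun W hW => ?_
      have hne : φ ⟨V, hV⟩ ≠ φ ⟨W, hW.1⟩ := fun h => hW.2 ⟨hW.1, h.symm⟩
      have h0 := hi _ _ hne
      rw [hf] at h0
      have hr : r V = r W := by
        by_contra hr
        simp [hr] at h0
      rw [hr]
      exact (hrw W (hsub hW.1)).subset.trans inter_subset_left
    · intro V W hne hr
      have h1 := hi V W hne
      rw [hf, if_pos hr] at h1
      exact absurd h1 (by decide)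
  -- Sets with equal label share a fibre of `φ`, which is finite.
  have hlevel : ∀ n, {V ∈ ⋃ m, 𝒢 m | r V = n}.Finite := by
    intro n
    rcases {V ∈ ⋃ m, 𝒢 m | r V = n}.eq_empty_or_nonempty with he | ⟨V, hV, rfl⟩
    · rw [he]
      exact finite_empty
    · refine (hφ' (φ ⟨V, hV⟩)).subset fun W hW => ⟨hW.1, ?_⟩
      by_contra hne
      exact hone _ _ hne hW.2
  refine exists_eventuallyStrong_of_grouping hfin hdisj hev r (fun n => ?_) fun V hV n hn => ?_
  · refine ((finite_lt_nat n).biUnion fun m _ => hlevel m).subset fun V hV => ?_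
    exact mem_biUnion (x := r V) hV.2 ⟨hV.1, rfl⟩
  · obtain ⟨U, hU, hs⟩ := exists_superset_of_mem_commonRefinement hn (hw V (hsub hV))
    exact ⟨U, hU, (hrw V (hsub hV)).subset.trans (inter_subset_right.trans hs)⟩

end Covers

end BornCover

theorem mainTheorem3 {X : Type*} [MetricSpace X] (𝔅 : Bornology X)
    (h_proper : (Set.univ : Set X) ∉ BornCover.sets 𝔅)
    (h_base : BornCover.HasClosedBase 𝔅) :
    List.TFAE [
      BornCover.HurewiczProperty 𝔅,
      BornCover.SFin (BornCover.openCovers 𝔅) (BornCover.groupableCovers 𝔅),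
      ¬ BornCover.OneHasWinningStrategy
          (BornCover.openCovers 𝔅) (BornCover.groupableCovers 𝔅)] ∧
    (BornCover.IsStrongLindelof 𝔅 →
      (BornCover.HurewiczProperty 𝔅 ↔
        ∀ k : ℕ, 1 ≤ k → BornCover.BaumgartnerTaylor
          (BornCover.openCovers 𝔅) (BornCover.groupableCovers 𝔅) k)) := by
  refine ⟨?_, fun hL => ⟨fun h k _ => h.baumgartnerTaylor k, fun h =>
    BornCover.hurewiczProperty_of_baumgartnerTaylor hL (h 2 one_le_two)⟩⟩
  tfae_have 1 → 3 := BornCover.HurewiczProperty.not_oneHasWinningStrategy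
  tfae_have 3 → 2 := BornCover.sFin_of_not_oneHasWinningStrategy
  tfae_have 2 → 1 := BornCover.hurewiczProperty_of_sFin
  tfae_finish
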